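/- Let $n\ge 1$ and $[n]=\{1,\dots,n\}$. The type $C_n$ Gale order on subsets of $[n]$ is the partial order in which $\{a_1<\cdots<a_j\}\le\{b_1<\cdots<b_k\}$ if and only if $j\le k$ and $a_{j-i+1}\le b_{k-i+1}$ for all $1\le i\le j$. For $S\le T$ let $[S,T]$ be the corresponding interval in this order, let $\Delta[S,T]$ be the delta matroid on $[n]$ whose feasible sets are the members of $[S,T]$, and let $$P(\Delta[S,T])=\operatorname{conv}\Bigl(\sum_{i\in A}e_i \;:\; A\in[S,T]\Bigr)\subseteq\mathbb{R}^n$$ be its feasible polytope. Proposition. Let $S\subseteq[n-1]$ and $T=S\cup\{n\}$ (these are exactly the linked toric intervals $[S,T]$, that is, the toric ones for which $P(\Delta[S,T])$ has dimension $n$). Then the $n$-dimensional Lebesgue volume of $P(\Delta[S,T])$ is $$\operatorname{vol} P(\Delta[S,T])=\frac{\#\{\text{maximal chains of the poset }[S,T]\}}{n!}.$$ -/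

import Mathlib

open MeasureTheory

/-- A subset of `[n] = {1, …, n}`, viewed as an element of the type `C_n` Gale order.
The element `i : Fin n` stands for the integer `i + 1 ∈ [n]`. -/
@[ext]
structure GaleSubset (n : ℕ) where
  toFinset : Finset (Fin n)

namespace GaleSubset

variable {n : ℕ}

/-- The type `C_n` Gale order. Write `A = {a_1 < ⋯ < a_j}` and `B = {b_1 < ⋯ < b_k}`; then `A ≤ B`
iff `j ≤ k` and the `i`-th largest element of `A` is at most the `i`-th largest element of `B`
for every `i ≤ j`; that is, `a_m ≤ b_{m + (k - j)}` for every `m ≤ j`. -/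
instance : LE (GaleSubset n) where
  le A B := ∃ h : A.toFinset.card ≤ B.toFinset.card, ∀ m : Fin A.toFinset.card,
    A.toFinset.orderEmbOfFin rfl m ≤
      B.toFinset.orderEmbOfFin rfl
        ⟨m + (B.toFinset.card - A.toFinset.card), by have := m.isLt; omega⟩

theorem toFinset_subset_of_le_of_le {A B : GaleSubset n} (hAB : A ≤ B) (hBA : B ≤ A) :
    A.toFinset ⊆ B.toFinset := by
  obtain ⟨h₁, h₂⟩ := hAB
  obtain ⟨h₃, h₄⟩ := hBA
  intro x hx
  have hx' : x ∈ Set.range (A.toFinset.orderEmbOfFin rfl) := by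
    rw [Finset.range_orderEmbOfFin]; exact hx
  obtain ⟨m, rfl⟩ := hx'
  have e₁ := h₂ m
  have e₂ := h₄ ⟨m + (B.toFinset.card - A.toFinset.card), by have := m.isLt; omega⟩
  have e₃ : (⟨m + (B.toFinset.card - A.toFinset.card) +
      (A.toFinset.card - B.toFinset.card), by have := m.isLt; omega⟩ :
        Fin A.toFinset.card) = m := by
    ext; simp only; omega
  simp only [e₃] at e₂
  rw [le_antisymm e₁ e₂]
  exact Finset.orderEmbOfFin_mem _ _ _

instance : PartialOrder (GaleSubset n) where
  le_refl A := ⟨le_rfl, fun m => by simp⟩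
  le_trans A B C := by
    rintro ⟨h₁, h₂⟩ ⟨h₃, h₄⟩
    refine ⟨h₁.trans h₃, fun m => (h₂ m).trans ((h₄ _).trans (le_of_eq ?_))⟩
    congr 1
    ext
    simp only
    omega
  le_antisymm A B hAB hBA :=
    GaleSubset.ext (Finset.Subset.antisymm (toFinset_subset_of_le_of_le hAB hBA)
      (toFinset_subset_of_le_of_le hBA hAB))

/-- The point `e_A = ∑_{i ∈ A} e_i` of `ℝ^n`. -/
noncomputable def indicatorVec (A : GaleSubset n) : Fin n → ℝ :=
  ∑ i ∈ A.toFinset, Pi.single i (1 : ℝ)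

end GaleSubset

/-- The feasible polytope `conv (e_A : A ∈ 𝓕)` of a (delta matroid given by its) collection `𝓕` of
feasible sets. -/
noncomputable def feasiblePolytope {n : ℕ} (𝓕 : Set (GaleSubset n)) : Set (Fin n → ℝ) :=
  convexHull ℝ (GaleSubset.indicatorVec '' 𝓕)

/-- The collection of feasible sets of the lattice path delta matroid `Δ[S, T]`: the interval
`[S, T]` in the type `C_n` Gale order. -/
def latticePathFeasible {n : ℕ} (S T : GaleSubset n) : Set (GaleSubset n) :=
  Set.Icc S T

/-!
Write `h_A(i)` for the number of elements of `A` that are at least `i`. The Gale order is the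
pointwise order of these suffix counts (`GaleSubset.le_iff_suffixCount`), and passing from `S` to
`T = S ∪ {n}` raises every suffix count by one. Hence `A ∈ [S, T]` iff `h_A = h_S + 1_U` for some
`U ⊆ [n]`. Which `U` occur is decided by comparing neighbouring positions: `U` has to be closed under
`i ↦ i + 1` for `i ∈ S` and under `i + 1 ↦ i` for `i ∉ S`. So `[S, T]` is isomorphic to the lattice
of up-sets of a zigzag poset (`exists_orderIso_upClosed`). The map `e_A ↦ h_A` is linear with
unitriangular matrix, and it carries the feasible polytope to a translate of the order polytope of
the zigzag (`volume_feasiblePolytope`).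

It remains to see that both sides count linear extensions of the zigzag. The hyperplanes `y i = y j`
cut the unit cube into `n!` chambers of equal volume, and an order polytope is, up to a null set, the
union of the chambers of the linear extensions (`volume_orderPolytope`). On the other hand, the final
segments of a linear extension form a maximal chain of up-sets, and every maximal chain arises in
this way from exactly one linear extension (`card_flag_upClosed`).

Only a relation generating the poset is used, never the partial order itself; antisymmetry enters
as the statement that the up-closed sets separate points (`zigzag_separates`).
-/

/-! ### Maximal chains of up-closed sets and linear extensions -/

/-- The subsets of `Fin n` closed under a relation `R`, ordered by inclusion. With `R` the order
relation of a poset (or any relation generating it) these are the up-sets of that poset. -/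
abbrev UpClosed {n : ℕ} (R : Fin n → Fin n → Prop) : Type :=
  {U : Finset (Fin n) // ∀ i j, R i j → i ∈ U → j ∈ U}

/-- The linear extensions of `R`, given by their rank functions: `r i` is the position of `i`. -/
def linearExtensions {n : ℕ} (R : Fin n → Fin n → Prop) : Set (Equiv.Perm (Fin n)) :=
  {r | ∀ i j, R i j → r i ≤ r j}

section Flags

variable {n : ℕ} {R : Fin n → Fin n → Prop}

/-- The elements of rank larger than that of `i`, as a set closed under `R`. -/
def upperSegment (r : linearExtensions R) (i : Fin n) : UpClosed R :=
  ⟨({x | r.1 i < r.1 x} : Finset (Fin n)), fun a b hab ha => by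
    simp only [Finset.mem_filter, Finset.mem_univ, true_and] at ha ⊢
    exact ha.trans_le (r.2 a b hab)⟩

theorem mem_upperSegment (r : linearExtensions R) (i x : Fin n) :
    x ∈ (upperSegment r i).1 ↔ r.1 i < r.1 x := by
  simp [upperSegment]

/-- The maximal chain attached to a linear extension: it consists of the sets which are final
segments for the ranking `r`. -/
def flagOfLinearExtension (r : linearExtensions R) : Flag (UpClosed R) where
  carrier := {U | ∀ i ∈ U.1, ∀ j ∉ U.1, r.1 j < r.1 i}
  Chain' := by
    intro U hU V hV _
    by_contra! h
    obtain ⟨x, hxU, hxV⟩ := Finset.not_subset.1 h.1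
    obtain ⟨y, hyV, hyU⟩ := Finset.not_subset.1 h.2
    exact lt_asymm (hU x hxU y hyU) (hV y hyV x hxV)
  max_chain' := by
    intro s hs hsub
    refine hsub.antisymm fun V hV i hi j hj => ?_
    -- Otherwise `V` would be incomparable to the final segment above `i`.
    by_contra hij
    have hlt : r.1 i < r.1 j :=
      lt_of_le_of_ne (not_lt.1 hij) fun h => hj (r.1.injective h ▸ hi)
    have hW : upperSegment r i ∈ s := hsub fun a ha b hb => by
      rw [mem_upperSegment] at ha hb
      exact (not_lt.1 hb).trans_lt ha
    rcases hs.total hV hW with h | h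
    · exact lt_irrefl _ ((mem_upperSegment r i i).1 (h hi))
    · exact hj (h ((mem_upperSegment r i j).2 hlt))

theorem perm_eq_of_forall_lt {r r' : Equiv.Perm (Fin n)}
    (h : ∀ i j, r i < r j → r' i < r' j) : r = r' := by
  have hmono : StrictMono (r.symm.trans r') := fun a b hab => by
    simpa using h (r.symm a) (r.symm b) (by simpa using hab)
  have hid := (Equiv.Perm.monotone_iff _).1 hmono.monotone
  refine Equiv.ext fun i => ?_
  have := congrArg (fun e : Equiv.Perm (Fin n) => e (r i)) hid
  simpa using this.symm

theorem flagOfLinearExtension_injective :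
    Function.Injective (flagOfLinearExtension (R := R)) := by
  intro r r' h
  refine Subtype.ext (perm_eq_of_forall_lt fun j i hij => ?_)
  have hW : upperSegment r j ∈ flagOfLinearExtension r := fun a ha b hb => by
    rw [mem_upperSegment] at ha hb
    exact (not_lt.1 hb).trans_lt ha
  rw [h] at hW
  exact hW i ((mem_upperSegment r j i).2 hij) j (by simp [mem_upperSegment])

/-- A maximal chain of `R`-closed sets separates any two points that are separated by some
`R`-closed set `U`: otherwise let `X` be the union of the members missing both points and `Y` the
intersection of the members containing both; then `X ∪ (Y ∩ U)` could be added to the chain. -/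
theorem Flag.exists_separating (c : Flag (UpClosed R)) {i j : Fin n} (U : UpClosed R)
    (hU : ¬ (i ∈ U.1 ↔ j ∈ U.1)) : ∃ X ∈ c, ¬ (i ∈ X.1 ↔ j ∈ X.1) := by
  classical
  by_contra! hc
  let X : Finset (Fin n) := {x | ∃ V ∈ c, i ∉ V.1 ∧ x ∈ V.1}
  let Y : Finset (Fin n) := {x | ∀ V ∈ c, i ∈ V.1 → x ∈ V.1}
  have hX : ∀ x, x ∈ X ↔ ∃ V ∈ c, i ∉ V.1 ∧ x ∈ V.1 := fun x => by simp [X]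
  have hY : ∀ x, x ∈ Y ↔ ∀ V ∈ c, i ∈ V.1 → x ∈ V.1 := fun x => by simp [Y]
  let Z : UpClosed R := ⟨X ∪ (Y ∩ U.1), fun a b hab ha => by
    rw [Finset.mem_union, Finset.mem_inter, hX, hY] at ha ⊢
    rcases ha with ⟨V, hV, hi, ha⟩ | ⟨ha, haU⟩
    · exact Or.inl ⟨V, hV, hi, V.2 a b hab ha⟩
    · exact Or.inr ⟨fun V hV hi => V.2 a b hab (ha V hV hi), U.2 a b hab haU⟩⟩
  have hZ : ∀ x, x ∈ Z.1 ↔ x ∈ X ∨ x ∈ Y ∧ x ∈ U.1 := fun x => by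
    simp only [Z, Finset.mem_union, Finset.mem_inter]
  have hZc : Z ∈ c := by
    rw [Flag.mem_iff_forall_le_or_ge]
    intro W hW
    by_cases hi : i ∈ W.1
    · left
      intro x hx
      rcases (hZ x).1 hx with hx | ⟨hx, -⟩
      · obtain ⟨V, hV, hiV, hxV⟩ := (hX x).1 hx
        rcases c.le_or_le hV hW with h | h
        · exact h hxV
        · exact absurd (h hi) hiV
      · exact (hY x).1 hx W hW hi
    · right
      intro x hx
      exact (hZ x).2 (Or.inl ((hX x).2 ⟨W, hW, hi, hx⟩))
  have hi : i ∈ Z.1 ↔ i ∈ U.1 := by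
    rw [hZ, hX, hY]
    constructor
    · rintro (⟨V, -, h, h'⟩ | h)
      exacts [absurd h' h, h.2]
    · exact fun h => Or.inr ⟨fun V _ h => h, h⟩
  have hj : j ∈ Z.1 ↔ j ∈ U.1 := by
    rw [hZ, hX, hY]
    constructor
    · rintro (⟨V, hV, h, h'⟩ | h)
      exacts [absurd ((hc V hV).2 h') h, h.2]
    · exact fun h => Or.inr ⟨fun V hV => (hc V hV).1, h⟩
  exact hU (hi.symm.trans ((hc Z hZc).trans hj))

/-- If the `R`-closed sets separate points, every maximal chain comes from a linear extension. The
rank of `i` is, up to a shift by one, the number of members of the chain that contain `i`. -/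
theorem flagOfLinearExtension_surjective
    (hR : ∀ i j : Fin n, i ≠ j → ∃ U : UpClosed R, ¬ (i ∈ U.1 ↔ j ∈ U.1)) :
    Function.Surjective (flagOfLinearExtension (R := R)) := by
  classical
  intro c
  let F : Fin n → Finset (UpClosed R) := fun i => {X | X ∈ c ∧ i ∈ X.1}
  have hF : ∀ i X, X ∈ F i ↔ X ∈ c ∧ i ∈ X.1 := fun i X => by simp [F]
  have hlt : ∀ X ∈ c, ∀ i ∈ X.1, ∀ j ∉ X.1, (F j).card < (F i).card := by
    intro X hX i hi j hj
    refine Finset.card_lt_card (Finset.ssubset_iff_of_subset ?_ |>.2 ⟨X, (hF i X).2 ⟨hX, hi⟩, ?_⟩)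
    · intro V hV
      rw [hF] at hV ⊢
      refine ⟨hV.1, ?_⟩
      rcases c.le_or_le hX hV.1 with h | h
      · exact h hi
      · exact absurd (h hV.2) hj
    · exact fun h => hj ((hF j X).1 h).2
  have hpos : ∀ i, 0 < (F i).card := fun i => by
    refine Finset.card_pos.2
      ⟨⟨Finset.univ, fun _ _ _ _ => Finset.mem_univ _⟩, (hF _ _).2 ⟨?_, by simp⟩⟩
    rw [Flag.mem_iff_forall_le_or_ge]
    exact fun V _ => Or.inr (Finset.subset_univ V.1)
  -- Members of a chain are determined by their cardinality, which lies in `{1, …, n}` here.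
  have hle : ∀ i, (F i).card ≤ n := fun i => by
    have : (F i).card ≤ (Finset.Icc 1 n).card := by
      refine Finset.card_le_card_of_injOn (fun X => X.1.card) ?_ ?_
      · intro X hX
        have h1 : 0 < X.1.card := Finset.card_pos.2 ⟨i, ((hF i X).1 hX).2⟩
        have h2 := X.1.card_le_univ
        simp only [Fintype.card_fin] at h2
        simp only [Finset.coe_Icc, Set.mem_Icc]
        omega
      · intro X hX Y hY hXY
        rcases c.le_or_le ((hF i X).1 hX).1 ((hF i Y).1 hY).1 with h | h
        · exact Subtype.ext (Finset.eq_of_subset_of_card_le h hXY.ge)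
        · exact (Subtype.ext (Finset.eq_of_subset_of_card_le h hXY.le)).symm
    simpa using this
  let f : Fin n → Fin n := fun i => ⟨(F i).card - 1, by have := hpos i; have := hle i; omega⟩
  have hflt : ∀ i j, (F j).card < (F i).card → f j < f i := fun i j h => by
    have := hpos j
    simp only [f, Fin.lt_def]
    omega
  have hinj : Function.Injective f := by
    intro i j hij
    by_contra hne
    obtain ⟨U, hU⟩ := hR i j hne
    obtain ⟨X, hX, hsep⟩ := c.exists_separating U hU
    by_cases hi : i ∈ X.1
    · by_cases hj : j ∈ X.1
      · exact hsep (iff_of_true hi hj)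
      · exact (hflt _ _ (hlt X hX i hi j hj)).ne hij.symm
    · by_cases hj : j ∈ X.1
      · exact (hflt _ _ (hlt X hX j hj i hi)).ne hij
      · exact hsep (iff_of_false hi hj)
  let r : Equiv.Perm (Fin n) := Equiv.ofBijective f (Finite.injective_iff_bijective.1 hinj)
  have hr : r ∈ linearExtensions R := fun i j hij => by
    have : (F i).card ≤ (F j).card := Finset.card_le_card fun X hX => by
      rw [hF] at hX ⊢
      exact ⟨hX.1, X.2 i j hij hX.2⟩
    simp only [r, Equiv.ofBijective_apply, f, Fin.le_def]
    omega
  refine ⟨⟨r, hr⟩, Flag.ext (c.max_chain' (flagOfLinearExtension ⟨r, hr⟩).chain_le ?_).symm⟩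
  intro X hX i hi j hj
  exact hflt i j (hlt X hX i hi j hj)

theorem card_flag_upClosed
    (hR : ∀ i j : Fin n, i ≠ j → ∃ U : UpClosed R, ¬ (i ∈ U.1 ↔ j ∈ U.1)) :
    Nat.card (Flag (UpClosed R)) = Nat.card (linearExtensions R) :=
  (Nat.card_congr (Equiv.ofBijective _
    ⟨flagOfLinearExtension_injective, flagOfLinearExtension_surjective hR⟩)).symm

end Flags

/-! ### The volume of an order polytope -/

/-- The order polytope of a relation `R`: the points of the unit cube whose coordinates are weakly
increasing along `R`. -/
def orderPolytope {n : ℕ} (R : Fin n → Fin n → Prop) : Set (Fin n → ℝ) :=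
  {y | (∀ i, y i ∈ Set.Icc (0 : ℝ) 1) ∧ ∀ i j, R i j → y i ≤ y j}

/-- The points of the unit cube whose coordinates are pairwise distinct and sorted as prescribed by
the ranking `r`. -/
def chamber {n : ℕ} (r : Equiv.Perm (Fin n)) : Set (Fin n → ℝ) :=
  {y | (∀ i, y i ∈ Set.Icc (0 : ℝ) 1) ∧ ∀ i j, r i < r j → y i < y j}

/-- The indicator vector of `U`, as a function. -/
def zeroOneVec {n : ℕ} (U : Finset (Fin n)) : Fin n → ℝ :=
  fun i => if i ∈ U then 1 else 0

section OrderPolytope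

variable {n : ℕ} {R : Fin n → Fin n → Prop}

theorem convex_orderPolytope : Convex ℝ (orderPolytope R) := by
  rintro x ⟨hx, hx'⟩ y ⟨hy, hy'⟩ a b ha hb hab
  refine ⟨fun i => convex_Icc (0 : ℝ) 1 (hx i) (hy i) ha hb hab, fun i j hij => ?_⟩
  simp only [Pi.add_apply, Pi.smul_apply, smul_eq_mul]
  have := hx' i j hij
  have := hy' i j hij
  gcongr

/-- The order polytope is spanned by the indicators of `R`-closed sets: a point `y` is the average
over `t ∈ [0, 1]` of the indicators of its superlevel sets `{i | t ≤ y i}`. -/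
theorem convexHull_zeroOneVec :
    convexHull ℝ (Set.range fun U : UpClosed R => zeroOneVec U.1) = orderPolytope R := by
  classical
  refine (convexHull_min ?_ convex_orderPolytope).antisymm ?_
  · rintro _ ⟨U, rfl⟩
    refine ⟨fun i => ?_, fun i j hij => ?_⟩
    · simp only [zeroOneVec]
      split_ifs <;> simp
    · have := U.2 i j hij
      simp only [zeroOneVec]
      by_cases hi : i ∈ U.1
      · simp [hi, this hi]
      · simp only [hi, if_false]
        split_ifs <;> simp
  · rintro y ⟨hy, hy'⟩
    let μ : Measure ℝ := volume.restrict (Set.Ioc 0 1)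
    have : IsProbabilityMeasure μ := ⟨by simp [μ]⟩
    let g : ℝ → Fin n → ℝ := fun t => zeroOneVec {i | t ≤ y i}
    have hg : ∀ t i, g t i = Set.indicator (Set.Iic (y i)) (fun _ => (1 : ℝ)) t := fun t i => by
      simp [g, zeroOneVec, Set.indicator_apply]
    have hint : Integrable g μ := by
      refine Integrable.of_eval fun i => ?_
      simp only [hg]
      exact (integrable_const 1).indicator measurableSet_Iic
    have hmem : ∀ t, g t ∈ convexHull ℝ (Set.range fun U : UpClosed R => zeroOneVec U.1) :=
      fun t => subset_convexHull _ _ ⟨⟨({i | t ≤ y i} : Finset (Fin n)), fun i j hij hi => by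
        simp only [Finset.mem_filter, Finset.mem_univ, true_and] at hi ⊢
        exact hi.trans (hy' i j hij)⟩, rfl⟩
    have hI := (convex_convexHull ℝ _).integral_mem
      (Set.Finite.isClosed_convexHull ℝ (Set.finite_range _)) (Filter.Eventually.of_forall hmem) hint
    convert hI
    ext i
    rw [eval_integral (fun i => hint.eval i)]
    simp only [hg]
    rw [integral_indicator_const _ measurableSet_Iic]
    have hs : Set.Iic (y i) ∩ Set.Ioc 0 1 = Set.Ioc 0 (y i) := by
      ext t
      have := (hy i).2
      simp only [Set.mem_inter_iff, Set.mem_Iic, Set.mem_Ioc]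
      constructor
      · tauto
      · exact fun h => ⟨h.2, h.1, h.2.trans this⟩
    simp [μ, Measure.real, Measure.restrict_apply measurableSet_Iic, hs, (hy i).1]

theorem measurableSet_chamber (r : Equiv.Perm (Fin n)) : MeasurableSet (chamber r) := by
  have : chamber r = (⋂ i, {y : Fin n → ℝ | y i ∈ Set.Icc (0 : ℝ) 1}) ∩
      ⋂ i, ⋂ j, ⋂ _ : r i < r j, {y : Fin n → ℝ | y i < y j} := by
    ext y
    simp only [chamber, Set.mem_inter_iff, Set.mem_iInter]
    rfl
  rw [this]
  refine MeasurableSet.inter ?_ ?_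
  · exact MeasurableSet.iInter fun i => measurable_pi_apply i measurableSet_Icc
  · exact MeasurableSet.iInter fun i => MeasurableSet.iInter fun j => MeasurableSet.iInter fun _ =>
      measurableSet_lt (measurable_pi_apply i) (measurable_pi_apply j)

/-- All chambers have the same volume, since permuting the coordinates preserves volume. -/
theorem volume_chamber (r : Equiv.Perm (Fin n)) :
    volume (chamber r) = volume (chamber (1 : Equiv.Perm (Fin n))) := by
  have h := (volume_measurePreserving_piCongrLeft (fun _ : Fin n => ℝ) r).measure_preimage
    (measurableSet_chamber 1).nullMeasurableSet
  rw [← h]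
  congr 1
  ext y
  have hy : ∀ i, MeasurableEquiv.piCongrLeft (fun _ : Fin n => ℝ) r y (r i) = y i := fun i =>
    Equiv.piCongrLeft_apply_apply (fun _ : Fin n => ℝ) r y i
  constructor
  · rintro ⟨h0, h1⟩
    refine ⟨fun i => ?_, fun i j hij => ?_⟩
    · obtain ⟨k, rfl⟩ := r.surjective i
      rw [hy]
      exact h0 k
    · obtain ⟨k, rfl⟩ := r.surjective i
      obtain ⟨l, rfl⟩ := r.surjective j
      rw [hy, hy]
      exact h1 k l hij
  · rintro ⟨h0, h1⟩
    refine ⟨fun i => ?_, fun i j hij => ?_⟩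
    · rw [← hy]
      exact h0 (r i)
    · rw [← hy i, ← hy j]
      exact h1 _ _ hij

theorem disjoint_chamber {r r' : Equiv.Perm (Fin n)} (h : r ≠ r') :
    Disjoint (chamber r) (chamber r') := by
  refine Set.disjoint_left.2 fun y hy hy' => h (perm_eq_of_forall_lt fun i j hij => ?_)
  by_contra hji
  rcases (not_lt.1 hji).lt_or_eq with hlt | heq
  · exact lt_asymm (hy.2 i j hij) (hy'.2 j i hlt)
  · exact hij.ne (congrArg r (r'.injective heq.symm))

theorem ae_injective : ∀ᵐ y : Fin n → ℝ, Function.Injective y := by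
  have key : ∀ i j : Fin n, ∀ᵐ y : Fin n → ℝ, y i = y j → i = j := by
    intro i j
    by_cases hij : i = j
    · exact Filter.Eventually.of_forall fun _ _ => hij
    let H : Submodule ℝ (Fin n → ℝ) :=
      LinearMap.ker (LinearMap.proj (R := ℝ) (φ := fun _ : Fin n => ℝ) i - LinearMap.proj j)
    have hmem : ∀ y, y ∈ H ↔ y i = y j := fun y => by simp [H, sub_eq_zero]
    have hH : H ≠ ⊤ := fun h => by
      have : Pi.single i (1 : ℝ) ∈ H := h ▸ Submodule.mem_top
      simp [hmem, Ne.symm hij] at this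
    have h0 := Measure.addHaar_submodule volume H hH
    refine measure_mono_null (fun y hy => ?_) h0
    rw [Set.mem_compl_iff, Set.mem_ofPred_eq, Classical.not_imp] at hy
    exact (hmem y).2 hy.1
  filter_upwards [ae_all_iff.2 fun i => ae_all_iff.2 (key i)] with y hy i j hij
  exact hy i j hij

/-- Up to a null set, the order polytope is the disjoint union of the chambers of the linear
extensions. -/
theorem volume_orderPolytope_eq_mul :
    volume (orderPolytope R) =
      Nat.card (linearExtensions R) * volume (chamber (1 : Equiv.Perm (Fin n))) := by
  have hae : orderPolytope R =ᵐ[volume] ⋃ r : linearExtensions R, chamber r.1 := by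
    filter_upwards [ae_injective (n := n)] with y hinj
    refine propext ⟨fun hy => ?_, fun hy => ?_⟩
    · have hs : StrictMono (y ∘ Tuple.sort y) :=
        (Tuple.monotone_sort y).strictMono_of_injective
          (hinj.comp (Tuple.sort y).injective)
      have hlt : ∀ i j, (Tuple.sort y).symm i < (Tuple.sort y).symm j ↔ y i < y j := fun i j => by
        rw [← hs.lt_iff_lt]
        simp
      refine Set.mem_iUnion.2 ⟨⟨(Tuple.sort y).symm, fun i j hij => ?_⟩, hy.1, fun i j => (hlt i j).1⟩
      rw [← not_lt, hlt, not_lt]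
      exact hy.2 i j hij
    · obtain ⟨r, h0, h1⟩ := Set.mem_iUnion.1 hy
      refine ⟨h0, fun i j hij => ?_⟩
      rcases (r.2 i j hij).lt_or_eq with h | h
      · exact (h1 i j h).le
      · rw [r.1.injective h]
  rw [measure_congr hae, measure_iUnion
    (fun r r' h => disjoint_chamber fun h' => h (Subtype.ext h'))
    (fun r => measurableSet_chamber r.1)]
  simp only [volume_chamber]
  rw [ENNReal.tsum_const, ENat.card_eq_coe_natCard]
  rfl

/-- The volume of an order polytope is the number of linear extensions divided by `n!`. For the
empty relation the polytope is the unit cube, which gives the volume of a single chamber. -/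
theorem volume_orderPolytope :
    volume (orderPolytope R) = (Nat.card (linearExtensions R) : ENNReal) / n.factorial := by
  have hcube : volume (orderPolytope fun _ _ : Fin n => False) = 1 := by
    have : orderPolytope (fun _ _ : Fin n => False) = Set.univ.pi fun _ => Set.Icc (0 : ℝ) 1 := by
      ext y
      exact ⟨fun h i _ => h.1 i, fun h => ⟨fun i => h i trivial, fun _ _ h => h.elim⟩⟩
    rw [this, volume_pi_pi]
    simp
  have hcard : Nat.card (linearExtensions fun _ _ : Fin n => False) = n.factorial := by
    have : linearExtensions (fun _ _ : Fin n => False) = Set.univ := by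
      ext r
      simp [linearExtensions]
    rw [this, Nat.card_congr (Equiv.Set.univ _), Nat.card_eq_fintype_card, Fintype.card_perm,
      Fintype.card_fin]
  rw [volume_orderPolytope_eq_mul, hcard, mul_comm] at hcube
  rw [volume_orderPolytope_eq_mul, ENNReal.eq_inv_of_mul_eq_one_left hcube, div_eq_mul_inv]

end OrderPolytope

/-! ### The Gale order through suffix counts -/

/-- The number of elements of `A` at (zero-based) position `i` or later. -/
def suffixCount {n : ℕ} (A : Finset (Fin n)) (i : ℕ) : ℕ :=
  (A.filter fun a : Fin n => i ≤ (a : ℕ)).card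

section Gale

variable {n : ℕ}

theorem suffixCount_zero (A : Finset (Fin n)) : suffixCount A 0 = A.card := by
  simp [suffixCount]

theorem suffixCount_self (A : Finset (Fin n)) : suffixCount A n = 0 := by
  simp [suffixCount, Finset.filter_eq_empty_iff]

theorem suffixCount_eq_add (A : Finset (Fin n)) (i : Fin n) :
    suffixCount A i = suffixCount A (i + 1) + if i ∈ A then 1 else 0 := by
  have hsplit : A.filter (fun a : Fin n => (i : ℕ) ≤ a) =
      A.filter (fun a : Fin n => (i : ℕ) + 1 ≤ a) ∪ A.filter (fun a => a = i) := by
    ext a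
    simp only [Finset.mem_filter, Finset.mem_union, Fin.ext_iff]
    grind
  rw [suffixCount, hsplit, Finset.card_union_of_disjoint, suffixCount, Finset.filter_eq']
  · split_ifs <;> simp
  · refine Finset.disjoint_filter.2 fun a _ h1 h2 => ?_
    rw [h2] at h1
    omega

/-- The number of elements of `A` from its `m`-th element (zero-based) on. -/
theorem suffixCount_orderEmbOfFin (A : Finset (Fin n)) (m : Fin A.card) :
    suffixCount A (A.orderEmbOfFin rfl m) = A.card - m := by
  have : A.filter (fun a : Fin n => (A.orderEmbOfFin rfl m : ℕ) ≤ a) =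
      (Finset.Ici m).map (A.orderEmbOfFin rfl).toEmbedding := by
    ext a
    simp only [Finset.mem_filter, Finset.mem_map, Finset.mem_Ici, RelEmbedding.coe_toEmbedding]
    constructor
    · rintro ⟨ha, hle⟩
      obtain ⟨k, rfl⟩ : a ∈ Set.range (A.orderEmbOfFin rfl) := by
        rw [Finset.range_orderEmbOfFin]; exact ha
      exact ⟨k, (A.orderEmbOfFin rfl).le_iff_le.1 hle, rfl⟩
    · rintro ⟨k, hk, rfl⟩
      exact ⟨Finset.orderEmbOfFin_mem _ _ _, (A.orderEmbOfFin rfl).monotone hk⟩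
  rw [suffixCount, this, Finset.card_map, Fin.card_Ici]

theorem suffixCount_antitone (A : Finset (Fin n)) : Antitone (suffixCount A) :=
  fun _ _ hij => Finset.card_le_card
    (Finset.monotone_filter_right A fun _ _ h => hij.trans h)

/-- The Gale order is the pointwise order of suffix counts. -/
theorem GaleSubset.le_iff_suffixCount {A B : GaleSubset n} :
    A ≤ B ↔ ∀ i, suffixCount A.toFinset i ≤ suffixCount B.toFinset i := by
  constructor
  · rintro ⟨hcard, h⟩ i
    by_cases hpos : suffixCount A.toFinset i = 0
    · omega
    -- Compare at the first element `a` of `A` at position `i` or later.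
    obtain ⟨m, hm, hmin⟩ := Finset.exists_min_image
      (Finset.univ.filter fun m : Fin A.toFinset.card => i ≤ (A.toFinset.orderEmbOfFin rfl m : ℕ)) id
      (by
        obtain ⟨a, ha⟩ := Finset.card_pos.1 (Nat.pos_of_ne_zero hpos)
        rw [Finset.mem_filter] at ha
        obtain ⟨k, rfl⟩ : a ∈ Set.range (A.toFinset.orderEmbOfFin rfl) := by
          rw [Finset.range_orderEmbOfFin]; exact ha.1
        exact ⟨k, by simpa using ha.2⟩)
    simp only [Finset.mem_filter, Finset.mem_univ, true_and, id] at hm hmin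
    have h1 : suffixCount A.toFinset i ≤ suffixCount A.toFinset (A.toFinset.orderEmbOfFin rfl m) := by
      refine Finset.card_le_card fun a ha => ?_
      rw [Finset.mem_filter] at ha ⊢
      obtain ⟨k, rfl⟩ : a ∈ Set.range (A.toFinset.orderEmbOfFin rfl) := by
        rw [Finset.range_orderEmbOfFin]; exact ha.1
      exact ⟨ha.1, (A.toFinset.orderEmbOfFin rfl).monotone (hmin k ha.2)⟩
    have h2 := suffixCount_antitone B.toFinset (hm.trans (h m))
    rw [suffixCount_orderEmbOfFin] at h1 h2
    have := m.isLt
    simp only at h2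
    omega
  · intro h
    have hcard : A.toFinset.card ≤ B.toFinset.card := by
      simpa only [suffixCount_zero] using h 0
    refine ⟨hcard, fun m => ?_⟩
    by_contra! hlt
    have h1 := h (A.toFinset.orderEmbOfFin rfl m)
    have h2 := suffixCount_antitone B.toFinset (Nat.succ_le_of_lt hlt)
    have h3 := suffixCount_eq_add B.toFinset (B.toFinset.orderEmbOfFin rfl
        ⟨m + (B.toFinset.card - A.toFinset.card), by have := m.isLt; omega⟩)
    rw [if_pos (Finset.orderEmbOfFin_mem _ _ _), suffixCount_orderEmbOfFin] at h3
    rw [suffixCount_orderEmbOfFin] at h1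
    have := m.isLt
    simp only [Nat.succ_eq_add_one] at h2 h3
    omega

/-! ### Linked toric intervals and zigzag relations -/

/-- The zigzag relation of `S`: consecutive elements `i`, `i + 1` are related upwards if `i ∈ S` and
downwards if `i ∉ S`. -/
def zigzag (S : Finset (Fin n)) (i j : Fin n) : Prop :=
  ((j : ℕ) = i + 1 ∧ i ∈ S) ∨ ((i : ℕ) = j + 1 ∧ j ∉ S)

/-- Two points are separated by the initial or the final segment cut off right after the smaller of
the two. -/
theorem zigzag_separates (S : Finset (Fin n)) (i j : Fin n) (hij : i ≠ j) :
    ∃ U : UpClosed (zigzag S), ¬ (i ∈ U.1 ↔ j ∈ U.1) := by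
  wlog h : i < j generalizing i j
  · obtain ⟨U, hU⟩ := this j i hij.symm (lt_of_le_of_ne (not_lt.1 h) hij.symm)
    exact ⟨U, fun h => hU h.symm⟩
  by_cases hi : i ∈ S
  · refine ⟨⟨Finset.Ioi i, ?_⟩, by simp [h]⟩
    intro a b hab ha
    rw [Finset.mem_Ioi, Fin.lt_def] at ha ⊢
    rcases hab with ⟨h1, -⟩ | ⟨h1, h2⟩
    · omega
    · have : b ≠ i := fun h => h2 (h ▸ hi)
      have := Fin.val_ne_of_ne this
      omega
  · refine ⟨⟨Finset.Iic i, ?_⟩, by simp [h]⟩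
    intro a b hab ha
    rw [Finset.mem_Iic, Fin.le_def] at ha ⊢
    rcases hab with ⟨h1, h2⟩ | ⟨h1, -⟩
    · have : a ≠ i := fun h => hi (h ▸ h2)
      have := Fin.val_ne_of_ne this
      omega
    · omega

variable {S T : GaleSubset n}

theorem suffixCount_insert_last (hn : 0 < n)
    (hS : (⟨n - 1, Nat.sub_lt hn Nat.one_pos⟩ : Fin n) ∉ S.toFinset)
    (hT : T.toFinset = insert (⟨n - 1, Nat.sub_lt hn Nat.one_pos⟩ : Fin n) S.toFinset)
    (i : Fin n) : suffixCount T.toFinset i = suffixCount S.toFinset i + 1 := by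
  rw [suffixCount, hT, Finset.filter_insert, if_pos (by have := i.isLt; simp only; omega),
    Finset.card_insert_of_notMem fun h => hS (Finset.mem_filter.1 h).1, suffixCount]

/-- A set lies in `[S, T]` iff its suffix counts exceed those of `S` by zero or one. -/
theorem mem_Icc_iff_suffixCount
    (hST : ∀ i : Fin n, suffixCount T.toFinset i = suffixCount S.toFinset i + 1)
    {A : GaleSubset n} : A ∈ Set.Icc S T ↔ ∀ i : Fin n,
      suffixCount S.toFinset i ≤ suffixCount A.toFinset i ∧
        suffixCount A.toFinset i ≤ suffixCount S.toFinset i + 1 := by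
  have hlarge : ∀ (B : Finset (Fin n)) i, n ≤ i → suffixCount B i = 0 := fun B i hi =>
    Nat.le_zero.1 ((suffixCount_antitone B hi).trans (suffixCount_self B).le)
  rw [Set.mem_Icc, GaleSubset.le_iff_suffixCount, GaleSubset.le_iff_suffixCount]
  constructor
  · rintro ⟨h1, h2⟩ i
    exact ⟨h1 i, hST i ▸ h2 i⟩
  · intro h
    constructor
    all_goals
      intro i
      rcases lt_or_ge i n with hi | hi
      · have := h ⟨i, hi⟩
        have := hST ⟨i, hi⟩
        simp only at *
        omega
      · rw [hlarge _ i hi, hlarge _ i hi]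

/-- The positions where the suffix counts of `A` exceed those of `S`. -/
def excessSet (S A : Finset (Fin n)) : Finset (Fin n) :=
  {i : Fin n | suffixCount A i = suffixCount S i + 1}

theorem mem_excessSet {S A : Finset (Fin n)} {i : Fin n} :
    i ∈ excessSet S A ↔ suffixCount A i = suffixCount S i + 1 := by
  simp [excessSet]

theorem excessSet_upClosed {S A : Finset (Fin n)}
    (hA : ∀ i : Fin n, suffixCount S i ≤ suffixCount A i ∧ suffixCount A i ≤ suffixCount S i + 1)
    (i j : Fin n) (hij : zigzag S i j) (hi : i ∈ excessSet S A) : j ∈ excessSet S A := by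
  rw [mem_excessSet] at hi ⊢
  have hj := hA j
  rcases hij with ⟨h1, h2⟩ | ⟨h1, h2⟩
  · have hA' := suffixCount_eq_add A i
    have hS' := suffixCount_eq_add S i
    rw [if_pos h2, ← h1] at hS'
    rw [← h1] at hA'
    split_ifs at hA' <;> omega
  · have hA' := suffixCount_eq_add A j
    have hS' := suffixCount_eq_add S j
    rw [if_neg h2, ← h1] at hS'
    rw [← h1] at hA'
    split_ifs at hA' <;> omega

/-- Every set closed under the zigzag relation occurs as an excess set. That the last position is not
in `S` makes the suffix counts of the set constructed here correct at that position. -/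
theorem exists_suffixCount_eq (hn : 0 < n) {S : Finset (Fin n)}
    (hS : (⟨n - 1, Nat.sub_lt hn Nat.one_pos⟩ : Fin n) ∉ S) (U : UpClosed (zigzag S)) :
    ∃ A : Finset (Fin n), ∀ i : Fin n,
      suffixCount A i = suffixCount S i + if i ∈ U.1 then 1 else 0 := by
  classical
  let u : ℕ → Prop := fun i => ∃ h : i < n, (⟨i, h⟩ : Fin n) ∈ U.1
  let A : Finset (Fin n) :=
    {i | (i ∈ S ∧ (u i ∨ ¬ u (i + 1))) ∨ (i ∉ S ∧ u i ∧ ¬ u (i + 1))}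
  have hA : ∀ i, i ∈ A ↔ (i ∈ S ∧ (u i ∨ ¬ u (i + 1))) ∨ (i ∉ S ∧ u i ∧ ¬ u (i + 1)) :=
    fun i => by simp [A]
  have key : ∀ i ≤ n, suffixCount A i = suffixCount S i + if u i then 1 else 0 := by
    intro i hi
    induction hi using Nat.decreasingInduction with
    | self =>
      have : ¬ u n := fun ⟨h, _⟩ => lt_irrefl _ h
      simp [suffixCount_self, this]
    | of_succ k hk ih =>
      have h1 := suffixCount_eq_add A ⟨k, hk⟩
      have h2 := suffixCount_eq_add S ⟨k, hk⟩
      simp only [hA] at h1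
      simp only at h1 h2
      have up : (⟨k, hk⟩ : Fin n) ∈ S → u k → u (k + 1) := fun hkS ⟨_, hk'⟩ => by
        have hne : k ≠ n - 1 := by
          rintro rfl
          exact hS hkS
        have hlt : k + 1 < n := by omega
        exact ⟨hlt, U.2 _ _ (Or.inl ⟨rfl, hkS⟩) hk'⟩
      have down : (⟨k, hk⟩ : Fin n) ∉ S → u (k + 1) → u k := fun hkS ⟨_, hk'⟩ =>
        ⟨hk, U.2 _ _ (Or.inr ⟨rfl, hkS⟩) hk'⟩
      rw [h1, h2, ih]
      by_cases a : (⟨k, hk⟩ : Fin n) ∈ S <;> by_cases b : u k <;> by_cases c : u (k + 1) <;>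
        simp [a, b, c] <;> tauto
  refine ⟨A, fun i => ?_⟩
  rw [key i i.isLt.le]
  congr 1
  exact if_congr ⟨fun ⟨_, h⟩ => h, fun h => ⟨i.isLt, h⟩⟩ rfl rfl

/-- The interval `[S, T]` is isomorphic to the lattice of sets closed under the zigzag relation. -/
theorem exists_orderIso_upClosed (hn : 0 < n)
    (hS : (⟨n - 1, Nat.sub_lt hn Nat.one_pos⟩ : Fin n) ∉ S.toFinset)
    (hST : ∀ i : Fin n, suffixCount T.toFinset i = suffixCount S.toFinset i + 1) :
    ∃ e : Set.Icc S T ≃o UpClosed (zigzag S.toFinset), ∀ (A : Set.Icc S T) (i : Fin n),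
      suffixCount A.1.toFinset i =
        suffixCount S.toFinset i + if i ∈ (e A).1 then 1 else 0 := by
  let f : Set.Icc S T → UpClosed (zigzag S.toFinset) := fun A =>
    ⟨excessSet S.toFinset A.1.toFinset,
      excessSet_upClosed ((mem_Icc_iff_suffixCount hST).1 A.2)⟩
  have hf : ∀ (A : Set.Icc S T) (i : Fin n), suffixCount A.1.toFinset i =
      suffixCount S.toFinset i + if i ∈ (f A).1 then 1 else 0 := fun A i => by
    have := (mem_Icc_iff_suffixCount hST).1 A.2 i
    simp only [f, mem_excessSet]
    split_ifs <;> omega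
  have hle : ∀ A B, f A ≤ f B ↔ A ≤ B := fun A B => by
    rw [← Subtype.coe_le_coe, ← Subtype.coe_le_coe, GaleSubset.le_iff_suffixCount]
    constructor
    · intro h i
      rcases lt_or_ge i n with hi | hi
      · have h1 := hf A ⟨i, hi⟩
        have h2 := hf B ⟨i, hi⟩
        have := @h ⟨i, hi⟩
        simp only at h1 h2
        rw [h1, h2]
        split_ifs <;> first | omega | tauto
      · have := (suffixCount_antitone A.1.toFinset hi).trans (suffixCount_self _).le
        omega
    · intro h i hi
      have h1 := hf A i
      have h2 := hf B i
      have := h i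
      rw [if_pos hi] at h1
      by_contra hi'
      rw [if_neg hi'] at h2
      omega
  have hsurj : Function.Surjective f := fun U => by
    obtain ⟨A, hA⟩ := exists_suffixCount_eq hn hS U
    refine ⟨⟨⟨A⟩, (mem_Icc_iff_suffixCount hST).2 fun i => ?_⟩, Subtype.ext (Finset.ext fun i => ?_)⟩
    · rw [hA]
      split_ifs <;> omega
    · simp only [f, mem_excessSet, hA]
      split_ifs with h <;> simp [h]
  exact ⟨RelIso.ofSurjective (OrderEmbedding.ofMapLEIff f hle) hsurj, hf⟩

/-! ### The change of coordinates -/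

/-- The matrix of the map sending the indicator vector of a set to its suffix counts. -/
def suffixMatrix (n : ℕ) : Matrix (Fin n) (Fin n) ℝ :=
  Matrix.of fun i j => if i ≤ j then 1 else 0

theorem det_suffixMatrix : (suffixMatrix n).det = 1 := by
  rw [Matrix.det_of_isUpperTriangular]
  · simp [suffixMatrix]
  · intro i j hij
    simp only [suffixMatrix, Matrix.of_apply]
    exact if_neg (not_le.2 hij)

theorem suffixMatrix_indicatorVec (A : GaleSubset n) :
    Matrix.toLin' (suffixMatrix n) A.indicatorVec = fun i : Fin n => (suffixCount A.toFinset i : ℝ) := by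
  ext i
  simp only [GaleSubset.indicatorVec, map_sum, Finset.sum_apply, Matrix.toLin'_apply,
    Matrix.mulVec_single_one, suffixMatrix, Matrix.col_apply, Matrix.of_apply, suffixCount]
  rw [Finset.sum_boole]
  rfl

end Gale

open scoped Pointwise in
/-- The unitriangular map to suffix counts sends the feasible polytope to a translate of an order
polytope, so the two have the same volume. -/
theorem volume_feasiblePolytope {n : ℕ} {S T : GaleSubset n} {R : Fin n → Fin n → Prop}
    (e : Set.Icc S T ≃ UpClosed R)
    (he : ∀ (A : Set.Icc S T) (i : Fin n), suffixCount A.1.toFinset i =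
      suffixCount S.toFinset i + if i ∈ (e A).1 then 1 else 0) :
    volume (feasiblePolytope (latticePathFeasible S T)) = volume (orderPolytope R) := by
  have himage : Matrix.toLin' (suffixMatrix n) '' feasiblePolytope (latticePathFeasible S T) =
      (fun i : Fin n => (suffixCount S.toFinset i : ℝ)) +ᵥ orderPolytope R := by
    rw [feasiblePolytope, LinearMap.image_convexHull, ← convexHull_zeroOneVec, ← convexHull_vadd]
    congr 1
    have hval : ∀ A : Set.Icc S T, Matrix.toLin' (suffixMatrix n) A.1.indicatorVec =
        (fun i : Fin n => (suffixCount S.toFinset i : ℝ)) +ᵥ zeroOneVec (e A).1 := fun A => by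
      rw [suffixMatrix_indicatorVec]
      ext i
      rw [he A i]
      simp [zeroOneVec]
    ext y
    constructor
    · rintro ⟨_, ⟨A, hA, rfl⟩, rfl⟩
      rw [hval ⟨A, hA⟩]
      exact Set.vadd_mem_vadd_set ⟨_, rfl⟩
    · rintro ⟨_, ⟨U, rfl⟩, rfl⟩
      refine ⟨_, ⟨(e.symm U).1, (e.symm U).2, rfl⟩, ?_⟩
      rw [hval, e.apply_symm_apply]
  have hvol := Measure.addHaar_image_linearMap volume (Matrix.toLin' (suffixMatrix n))
    (feasiblePolytope (latticePathFeasible S T))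
  rw [himage, measure_vadd, LinearMap.det_toLin', det_suffixMatrix] at hvol
  simpa using hvol.symm

/-- The largest element `n` of `[n]` is `⟨n - 1, _⟩ : Fin n`. A maximal chain of the interval
`[S, T]` is a `Flag` of the poset `Set.Icc S T`, and `volume` is Lebesgue measure on `ℝ^n`. -/
theorem mainTheorem6 (n : ℕ) (hn : 0 < n) (S T : GaleSubset n)
    (hS : (⟨n - 1, Nat.sub_lt hn Nat.one_pos⟩ : Fin n) ∉ S.toFinset)
    (hT : T.toFinset = insert (⟨n - 1, Nat.sub_lt hn Nat.one_pos⟩ : Fin n) S.toFinset) :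
    volume (feasiblePolytope (latticePathFeasible S T)) =
      (Nat.card (Flag (Set.Icc S T)) : ENNReal) / (n.factorial : ENNReal) := by
  obtain ⟨e, he⟩ := exists_orderIso_upClosed hn hS (suffixCount_insert_last hn hS hT)
  rw [volume_feasiblePolytope e.toEquiv he, volume_orderPolytope,
    Nat.card_congr (Flag.map e), card_flag_upClosed (zigzag_separates S.toFinset)]
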